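/- A finite-dimensional nilpotent rational Lie algebra is called *Anosov* if it admits a Lie algebra automorphism $A$ none of whose complex eigenvalues has absolute value $1$ and such that the characteristic polynomial of $A$ has integer coefficients and $\det A=\pm1$. A *positive grading* of a Lie algebra $\mathfrak{n}$ is a vector space decomposition $\mathfrak{n}=\bigoplus_{i\ge 1}\mathfrak{n}_i$, indexed by the positive integers, with $[\mathfrak{n}_i,\mathfrak{n}_j]\subseteq\mathfrak{n}_{i+j}$ for all $i,j\geq 1$. For a field $E$ of characteristic $0$ let $\mathfrak{n}^E$ be the Lie algebra over $E$ with basis $X_1,X_2,X_3,X_4,Y_1,Y_2,Z_1,Z_2,V_1,V_2,W_1,W_2$ and brackets $$[X_1,X_3]=Y_1,\quad [X_1,Y_1]=Z_1,\quad [X_1,Z_1]=V_1,\quad [X_3,V_1]=[Z_1,Y_1]=[X_1,X_4]=W_1,$$ $$[X_2,X_4]=Y_2,\quad [X_2,Y_2]=Z_2,\quad [X_2,Z_2]=V_2,\quad [X_4,V_2]=[Z_2,Y_2]=[X_2,X_3]=W_2,$$ all other brackets of basis vectors being zero, up to antisymmetry. Let $k$ be a positive integer that is not a square, let $E=\mathbb{Q}(\sqrt{k})$,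 and let $\tau$ be the non-trivial element of $\mathrm{Gal}(E/\mathbb{Q})$. For $\sigma\in\mathrm{Gal}(E/\mathbb{Q})$ write $v^\sigma$ for the vector obtained from $v\in\mathfrak{n}^E$ by applying $\sigma$ to its coordinates in the above basis. Let $\rho_{1}$ be the identity of $\mathfrak{n}^E$ and let $\rho_\tau$ be the $E$-linear automorphism of $\mathfrak{n}^E$ that exchanges the basis vectors in the pairs $X_1\leftrightarrow X_2$, $X_3\leftrightarrow X_4$, $Y_1\leftrightarrow Y_2$, $Z_1\leftrightarrow Z_2$, $V_1\leftrightarrow V_2$, $W_1\leftrightarrow W_2$. Define the rational Lie algebra $$\mathfrak{m}_k^{\mathbb{Q}}=\{v\in\mathfrak{n}^E \mid \rho_\sigma(v)=v^\sigma \text{ for all } \sigma\in\mathrm{Gal}(E/\mathbb{Q})\}.$$ **Corollary.** For every $n\ge14$ there exists a rational Anosov Lie algebra of dimension $n$ with no positive grading. In fact, for every positive integer $k$ that is not a square, the direct sum $\mathfrak{m}_k^{\mathbb{Q}}\oplus\mathbb{Q}^{n-12}$, where $\mathbb{Q}^{n-12}$ is the abelian Lie algebra of dimension $n-12$, is a rational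 Anosov Lie algebra of dimension $n$ with no positive grading. -/

import Mathlib

open scoped IntermediateField

/-- A linear endomorphism of a finite-dimensional rational vector space is hyperbolic if none of
its (complex) eigenvalues has absolute value `1`. -/
def IsHyperbolic {V : Type*} [AddCommGroup V] [Module ℚ V] [FiniteDimensional ℚ V]
    (A : V →ₗ[ℚ] V) : Prop :=
  ∀ z : ℂ, Polynomial.aeval z A.charpoly = 0 → ‖z‖ ≠ 1

/-- A linear endomorphism of a finite-dimensional rational vector space is integer-like if its
characteristic polynomial has integer coefficients and its determinant is `1` or `-1`. -/
def IsIntegerLike {V : Type*} [AddCommGroup V] [Module ℚ V] [FiniteDimensional ℚ V]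
    (A : V →ₗ[ℚ] V) : Prop :=
  (∃ p : Polynomial ℤ, A.charpoly = p.map (Int.castRingHom ℚ)) ∧
    (LinearMap.det A = 1 ∨ LinearMap.det A = -1)

/-- An automorphism of a rational Lie algebra is Anosov if it is hyperbolic and integer-like. -/
def IsAnosovAutomorphism {L : Type*} [LieRing L] [LieAlgebra ℚ L] [FiniteDimensional ℚ L]
    (A : L ≃ₗ⁅ℚ⁆ L) : Prop :=
  IsHyperbolic (A : L →ₗ[ℚ] L) ∧ IsIntegerLike (A : L →ₗ[ℚ] L)

/-- A rational Lie algebra is Anosov if it is finite-dimensional and nilpotent, and has an Anosov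
automorphism. -/
def IsAnosovLieAlgebra (L : Type*) [LieRing L] [LieAlgebra ℚ L] : Prop :=
  LieRing.IsNilpotent L ∧
    ∃ _ : FiniteDimensional ℚ L, ∃ A : L ≃ₗ⁅ℚ⁆ L, IsAnosovAutomorphism A

/-- A positive grading of a Lie algebra: a decomposition as a direct sum of subspaces `N i`, indexed
by the positive integers, with `[N i, N j] ⊆ N (i + j)`. -/
def HasPositiveGrading (K L : Type*) [Field K] [LieRing L] [LieAlgebra K L] : Prop :=
  ∃ N : ℕ+ → Submodule K L, DirectSum.IsInternal N ∧
    ∀ i j : ℕ+, ∀ x ∈ N i, ∀ y ∈ N j, ⁅x, y⁆ ∈ N (i + j)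

namespace TwelveDim

/-- The labels of the twelve basis vectors. -/
inductive Idx : Type
  | X1 | X2 | X3 | X4 | Y1 | Y2 | Z1 | Z2 | V1 | V2 | W1 | W2
  deriving DecidableEq

instance : Fintype Idx where
  elems := {.X1, .X2, .X3, .X4, .Y1, .Y2, .Z1, .Z2, .V1, .V2, .W1, .W2}
  complete i := by cases i <;> decide

/-- The underlying module of the Lie algebra `𝔫` with coefficients in `R`: the free module on the
twelve basis vectors, an element being given by its coordinates. -/
def NLie (R : Type*) : Type _ := Idx → R

namespace NLie

@[ext]
theorem ext {R : Type*} {v w : NLie R} (h : ∀ i : Idx, v i = w i) : v = w := funext h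

variable {R : Type*} [CommRing R]

instance : AddCommGroup (NLie R) := inferInstanceAs (AddCommGroup (Idx → R))

instance {S : Type*} [CommRing S] [Algebra S R] : Module S (NLie R) :=
  inferInstanceAs (Module S (Idx → R))

@[simp]
theorem add_apply (v w : NLie R) (i : Idx) : (v + w) i = v i + w i := rfl

@[simp]
theorem zero_apply (i : Idx) : (0 : NLie R) i = 0 := rfl

@[simp]
theorem smul_apply {S : Type*} [CommRing S] [Algebra S R] (c : S) (v : NLie R) (i : Idx) :
    (c • v) i = c • v i := rfl

/-- The alternating coordinate form `v i * w j - v j * w i`. -/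
def minor (v w : NLie R) (i j : Idx) : R := v i * w j - v j * w i

/-- The bracket with
`[X1, X3] = Y1`, `[X1, Y1] = Z1`, `[X1, Z1] = V1`, `[X3, V1] = [Z1, Y1] = [X1, X4] = W1`,
`[X2, X4] = Y2`, `[X2, Y2] = Z2`, `[X2, Z2] = V2`, `[X4, V2] = [Z2, Y2] = [X2, X3] = W2`,
and with all brackets of basis vectors that do not follow from these by antisymmetry equal
to zero. -/
def bracket (v w : NLie R) : NLie R
  | .X1 => 0
  | .X2 => 0
  | .X3 => 0
  | .X4 => 0
  | .Y1 => minor v w .X1 .X3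
  | .Y2 => minor v w .X2 .X4
  | .Z1 => minor v w .X1 .Y1
  | .Z2 => minor v w .X2 .Y2
  | .V1 => minor v w .X1 .Z1
  | .V2 => minor v w .X2 .Z2
  | .W1 => minor v w .X3 .V1 + minor v w .Z1 .Y1 + minor v w .X1 .X4
  | .W2 => minor v w .X4 .V2 + minor v w .Z2 .Y2 + minor v w .X2 .X3

instance : Bracket (NLie R) (NLie R) := ⟨bracket⟩

theorem lie_def (v w : NLie R) : ⁅v, w⁆ = bracket v w := rfl

instance : LieRing (NLie R) where
  add_lie u v w := by
    ext i; cases i <;> simp [lie_def, bracket, minor] <;> ring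
  lie_add u v w := by
    ext i; cases i <;> simp [lie_def, bracket, minor] <;> ring
  lie_self v := by
    ext i; cases i <;> simp [lie_def, bracket, minor] <;> ring
  leibniz_lie u v w := by
    ext i; cases i <;> simp [lie_def, bracket, minor] <;> ring

instance {S : Type*} [CommRing S] [Algebra S R] : LieAlgebra S (NLie R) where
  lie_smul c v w := by
    ext i; cases i <;> simp [lie_def, bracket, minor, Algebra.smul_def] <;> ring

end NLie

/-- The involution of the labels that exchanges `X1, X2`, and `X3, X4`, and `Y1, Y2`, and so on. -/
def swapIdx : Idx → Idx
  | .X1 => .X2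
  | .X2 => .X1
  | .X3 => .X4
  | .X4 => .X3
  | .Y1 => .Y2
  | .Y2 => .Y1
  | .Z1 => .Z2
  | .Z2 => .Z1
  | .V1 => .V2
  | .V2 => .V1
  | .W1 => .W2
  | .W2 => .W1

/-- The automorphism of `𝔫` that permutes the basis vectors by `swapIdx`. -/
def swapAut (R : Type*) [CommRing R] : NLie R ≃ₗ⁅R⁆ NLie R where
  toFun v := fun i => v (swapIdx i)
  invFun v := fun i => v (swapIdx i)
  map_add' _ _ := rfl
  map_smul' _ _ := rfl
  map_lie' := by
    intro v w
    ext i; cases i <;> rfl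
  left_inv v := by ext i; cases i <;> rfl
  right_inv v := by ext i; cases i <;> rfl

/-- The real quadratic field `ℚ(√k)`, as a subfield of `ℝ`. -/
noncomputable abbrev quadField (k : ℕ) : IntermediateField ℚ ℝ := ℚ⟮√(k : ℝ)⟯

open Classical in
/-- The Galois group of `ℚ(√k)` acts on `𝔫` linearly: the identity acts trivially, and the
non-trivial element acts by exchanging the basis vectors in pairs. -/
noncomputable def rho (k : ℕ) (σ : quadField k ≃ₐ[ℚ] quadField k) :
    NLie (quadField k) ≃ₗ⁅quadField k⁆ NLie (quadField k) :=
  if σ = 1 then LieEquiv.refl else swapAut (quadField k)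

/-- The semilinear action of the Galois group of `ℚ(√k)` on the coordinates. -/
noncomputable def galConj {k : ℕ} (σ : quadField k ≃ₐ[ℚ] quadField k) (v : NLie (quadField k)) :
    NLie (quadField k) :=
  fun i => σ (v i)

theorem galConj_lie {k : ℕ} (σ : quadField k ≃ₐ[ℚ] quadField k) (v w : NLie (quadField k)) :
    galConj σ ⁅v, w⁆ = ⁅galConj σ v, galConj σ w⁆ := by
  ext1 i
  cases i <;> simp [galConj, NLie.lie_def, NLie.bracket, NLie.minor]

/-- The rational Lie algebra `𝔪_k`: the rational form
`{v | ρ_σ(v) = v^σ for all σ ∈ Gal(ℚ(√k)/ℚ)}` of `𝔫` over `ℚ(√k)`. -/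
noncomputable def mLie (k : ℕ) : LieSubalgebra ℚ (NLie (quadField k)) where
  carrier := {v | ∀ σ : quadField k ≃ₐ[ℚ] quadField k, rho k σ v = galConj σ v}
  add_mem' := by
    intro v w hv hw σ
    rw [map_add, hv σ, hw σ]
    ext1 i
    simp [galConj]
  zero_mem' := by
    intro σ
    rw [map_zero]
    ext1 i
    simp [galConj]
  smul_mem' := by
    intro c v hv σ
    have h : c • v = (algebraMap ℚ (quadField k) c) • v := by
      ext1 i
      simp [Algebra.smul_def]
    have h2 : galConj σ (c • v) = (algebraMap ℚ (quadField k) c) • galConj σ v := by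
      ext1 i
      simp [galConj, Algebra.smul_def]
    rw [h2, h, map_smul, hv σ]
  lie_mem' := by
    intro v w hv hw σ
    rw [LieEquiv.map_lie, hv σ, hw σ, galConj_lie]

end TwelveDim

/-- The abelian rational Lie algebra `ℚ^d`. -/
def AbelianLie (d : ℕ) : Type := Fin d → ℚ

namespace AbelianLie

variable {d : ℕ}

instance : AddCommGroup (AbelianLie d) := inferInstanceAs (AddCommGroup (Fin d → ℚ))

instance : Module ℚ (AbelianLie d) := inferInstanceAs (Module ℚ (Fin d → ℚ))

instance : LieRing (AbelianLie d) where
  bracket _ _ := 0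
  add_lie _ _ _ := (add_zero 0).symm
  lie_add _ _ _ := (add_zero 0).symm
  lie_self _ := rfl
  leibniz_lie _ _ _ := (add_zero 0).symm

instance : LieAlgebra ℚ (AbelianLie d) where
  lie_smul c _ _ := (smul_zero c).symm

end AbelianLie

/-!
Let `E = ℚ(√k)` and let `τ` be its conjugation. The rational form `𝔪_k` is `E⁶` with coordinates
`x, u, y, z, v, w` (along `X1, X3, Y1, Z1, V1, W1`): the other six coordinates are conjugate to
these. The bracket is `E`-bilinear in them, except for one term `x * τ u' - x' * τ u` in the
coordinate `w`, which comes from `[X1, X4] = W1`.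

No positive grading. A grading yields the derivation `D` that multiplies each component by its
degree (`exists_lieDerivation_of_grading`). A derivation preserves the filtration by the
coordinates, whose members are described by brackets alone. Since `E` has no nonzero derivation,
`D` acts on the subquotients `x`, `u`, `y` as multiplication by elements `α`, `β`, `α + β` of `E`,
and on the last term of the lower central series, `w`, as multiplication by `3 α + 2 β`. The
semilinear term also makes this weight equal to `α + τ β`, so
`τ β = 2 α + 2 β` (`TwistedCoordinates.exists_weights`). But `α` is one of the degrees, hence a
positive integer. Applying `τ` gives `β = -2 α`, and the weight of `y` is `-α < 0`, although
brackets of homogeneous elements have positive degree. The abelian summand only enters through the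
centre, so it does not affect the argument.

Anosov automorphism. For a fundamental unit `μ` of norm `1`, supplied by Pell's equation, the
diagonal map with entries `μ ^ 3, μ ^ (-2), μ, μ ^ 4, μ ^ 7, μ ^ 5` on `X1, X3, Y1, Z1, V1, W1` and
the conjugate entries on the others is an automorphism of `𝔪_k`. As a rational map it is a product
of multiplications by powers `μ ^ e`, `e ≠ 0`, on `E`, with characteristic polynomials
`T ^ 2 - 2 x T + 1`, `|x| > 1` (`TwelveDim.isAnosovMap_mulLeft_pellUnit`). On the abelian summand of
dimension `d ≥ 2` one takes multiplication by `T` on `ℚ[T] / (T ^ d - 3 T ^ (d - 1) + 1)`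
(`exists_isAnosovMap_pi`).
-/

/-! ### Derivations and gradings -/

/-- The degree derivation of a graded Lie algebra: multiplication by `i` on the component of
degree `i`. -/
theorem exists_lieDerivation_of_grading {K L : Type*} [Field K] [LieRing L] [LieAlgebra K L]
    {N : ℕ+ → Submodule K L} (hN : DirectSum.IsInternal N)
    (hlie : ∀ i j : ℕ+, ∀ x ∈ N i, ∀ y ∈ N j, ⁅x, y⁆ ∈ N (i + j)) :
    ∃ D : LieDerivation K L L, ∀ i : ℕ+, ∀ x ∈ N i, D x = ((i : ℕ) : K) • x := by
  let e := LinearEquiv.ofBijective (DirectSum.coeLinearMap N) hN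
  let D₀ : L →ₗ[K] L :=
    (DirectSum.toModule K ℕ+ L fun i => ((i : ℕ) : K) • (N i).subtype) ∘ₗ e.symm.toLinearMap
  have hD₀ : ∀ i : ℕ+, ∀ x ∈ N i, D₀ x = ((i : ℕ) : K) • x := by
    intro i x hx
    have h : e.symm x = DirectSum.lof K ℕ+ (fun i => N i) i ⟨x, hx⟩ := by
      rw [LinearEquiv.symm_apply_eq]
      exact (DirectSum.coeLinearMap_lof N i ⟨x, hx⟩).symm
    simp [D₀, h]
  have htop : ∀ x : L, x ∈ ⨆ i, N i := fun x => by
    rw [hN.submodule_iSup_eq_top]; trivial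
  refine ⟨{ D₀ with leibniz' := fun p q => ?_ }, hD₀⟩
  change D₀ ⁅p, q⁆ = ⁅p, D₀ q⁆ - ⁅q, D₀ p⁆
  refine Submodule.iSup_induction N (motive := fun p => D₀ ⁅p, q⁆ = ⁅p, D₀ q⁆ - ⁅q, D₀ p⁆)
    (htop p) (fun i p hp => ?_) (by simp) (fun p p' h h' => ?_)
  · refine Submodule.iSup_induction N (motive := fun q => D₀ ⁅p, q⁆ = ⁅p, D₀ q⁆ - ⁅q, D₀ p⁆)
      (htop q) (fun j q hq => ?_) (by simp) (fun q q' h h' => ?_)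
    · rw [hD₀ _ _ (hlie i j p hp q hq), hD₀ i p hp, hD₀ j q hq, lie_smul, lie_smul,
        ← lie_skew q p, smul_neg, sub_neg_eq_add, ← add_smul]
      push_cast
      rw [add_comm]
    · rw [lie_add, map_add, h, h', map_add, lie_add, add_lie]
      abel
  · rw [add_lie, map_add, h, h', map_add, lie_add, add_lie]
    abel

/-- Coordinates on a rational Lie algebra `L` with values in a field `E` with an automorphism `τ`,
in which the bracket is the one of the six-dimensional Lie algebra on `X, U, Y, Z, V, W` with
`[X, U] = Y`, `[X, Y] = Z`, `[X, Z] = V`, `[U, V] = [Z, Y] = W`, together with the term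
`x * τ u'` in the coordinate `w`, which is only semilinear. Elements of `L` on which all six
coordinates vanish are allowed, but the bracket takes no such values apart from `0`. -/
structure TwistedCoordinates (E : Type*) [Field E] [Algebra ℚ E] (τ : E ≃ₐ[ℚ] E)
    (L : Type*) [LieRing L] [LieAlgebra ℚ L] where
  /-- the coordinate along `X` -/
  x : L →ₗ[ℚ] E
  /-- the coordinate along `U` -/
  u : L →ₗ[ℚ] E
  /-- the coordinate along `Y` -/
  y : L →ₗ[ℚ] E
  /-- the coordinate along `Z` -/
  z : L →ₗ[ℚ] E
  /-- the coordinate along `V` -/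
  v : L →ₗ[ℚ] E
  /-- the coordinate along `W` -/
  w : L →ₗ[ℚ] E
  x_lie : ∀ p q : L, x ⁅p, q⁆ = 0
  u_lie : ∀ p q : L, u ⁅p, q⁆ = 0
  y_lie : ∀ p q : L, y ⁅p, q⁆ = x p * u q - x q * u p
  z_lie : ∀ p q : L, z ⁅p, q⁆ = x p * y q - x q * y p
  v_lie : ∀ p q : L, v ⁅p, q⁆ = x p * z q - x q * z p
  w_lie : ∀ p q : L, w ⁅p, q⁆ = (u p * v q - u q * v p) + (z p * y q - z q * y p) +
    (x p * τ (u q) - x q * τ (u p))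
  /-- the element with given coordinates -/
  sec : (E × E × E × E × E × E) →ₗ[ℚ] L
  x_sec : ∀ a, x (sec a) = a.1
  u_sec : ∀ a, u (sec a) = a.2.1
  y_sec : ∀ a, y (sec a) = a.2.2.1
  z_sec : ∀ a, z (sec a) = a.2.2.2.1
  v_sec : ∀ a, v (sec a) = a.2.2.2.2.1
  w_sec : ∀ a, w (sec a) = a.2.2.2.2.2
  lie_eq_sec : ∀ p q : L, ⁅p, q⁆ = sec (0, 0, y ⁅p, q⁆, z ⁅p, q⁆, v ⁅p, q⁆, w ⁅p, q⁆)

namespace TwistedCoordinates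

attribute [simp] x_lie u_lie y_lie z_lie v_lie w_lie x_sec u_sec y_sec z_sec v_sec w_sec

variable {E : Type*} [Field E] [Algebra ℚ E] {τ : E ≃ₐ[ℚ] E}
  {L : Type*} [LieRing L] [LieAlgebra ℚ L] (c : TwistedCoordinates E τ L)
  (D : LieDerivation ℚ L L)

theorem lie_eq_zero_of_coords {r : L} (hx : c.x r = 0) (hu : c.u r = 0) (hy : c.y r = 0)
    (hz : c.z r = 0) (hv : c.v r = 0) (p : L) : ⁅r, p⁆ = 0 := by
  rw [c.lie_eq_sec]
  simp only [y_lie, z_lie, v_lie, w_lie, hx, hu, hy, hz, hv, map_zero, zero_mul,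
    mul_zero, sub_zero, add_zero]
  exact map_zero c.sec

/-- The subspace `x = u = y = z = v = 0` is stable under a derivation, being the centre. From it
the stability of the larger subspaces of the filtration is derived step by step. -/
theorem derivation_w {r : L} (hx : c.x r = 0) (hu : c.u r = 0) (hy : c.y r = 0)
    (hz : c.z r = 0) (hv : c.v r = 0) :
    c.x (D r) = 0 ∧ c.u (D r) = 0 ∧ c.y (D r) = 0 ∧ c.z (D r) = 0 ∧ c.v (D r) = 0 := by
  have key (p : L) : ⁅D r, p⁆ = 0 := by
    have h := D.apply_lie_eq_add r p
    rwa [c.lie_eq_zero_of_coords hx hu hy hz hv, c.lie_eq_zero_of_coords hx hu hy hz hv, map_zero,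
      zero_add, eq_comm] at h
  have h1 := congrArg c.y (key (c.sec (0, 1, 0, 0, 0, 0)))
  have h2 := congrArg c.y (key (c.sec (1, 0, 0, 0, 0, 0)))
  have h3 := congrArg c.z (key (c.sec (1, 0, 0, 0, 0, 0)))
  have h4 := congrArg c.v (key (c.sec (1, 0, 0, 0, 0, 0)))
  have h5 := congrArg c.w (key (c.sec (0, 1, 0, 0, 0, 0)))
  simp at h1 h2 h3 h4
  simp [h1] at h5
  exact ⟨h1, h2, h3, h4, h5⟩

theorem derivation_v {r : L} (hx : c.x r = 0) (hu : c.u r = 0) (hy : c.y r = 0)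
    (hz : c.z r = 0) :
    c.x (D r) = 0 ∧ c.u (D r) = 0 ∧ c.y (D r) = 0 ∧ c.z (D r) = 0 := by
  have key (p : L) : c.y ⁅D r, p⁆ = 0 ∧ c.z ⁅D r, p⁆ = 0 ∧ c.v ⁅D r, p⁆ = 0 := by
    have h : ⁅D r, p⁆ = D ⁅r, p⁆ - ⁅r, D p⁆ := by rw [D.apply_lie_eq_add]; abel
    have h' := c.derivation_w D (r := ⁅r, p⁆) (by simp) (by simp) (by simp [*]) (by simp [*])
      (by simp [*])
    simp only [h, map_sub, h']
    simp [hx, hu, hy, hz]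
  obtain ⟨h1, -, -⟩ := key (c.sec (0, 1, 0, 0, 0, 0))
  obtain ⟨h2, h3, h4⟩ := key (c.sec (1, 0, 0, 0, 0, 0))
  simp at h1 h2 h3 h4
  exact ⟨h1, h2, h3, h4⟩

theorem derivation_z {r : L} (hx : c.x r = 0) (hu : c.u r = 0) (hy : c.y r = 0) :
    c.x (D r) = 0 ∧ c.u (D r) = 0 ∧ c.y (D r) = 0 := by
  have key (p : L) : c.y ⁅D r, p⁆ = 0 ∧ c.z ⁅D r, p⁆ = 0 := by
    have h : ⁅D r, p⁆ = D ⁅r, p⁆ - ⁅r, D p⁆ := by rw [D.apply_lie_eq_add]; abel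
    have h' := c.derivation_v D (r := ⁅r, p⁆) (by simp) (by simp) (by simp [*]) (by simp [*])
    simp only [h, map_sub, h']
    simp [hx, hu, hy]
  obtain ⟨h1, -⟩ := key (c.sec (0, 1, 0, 0, 0, 0))
  obtain ⟨h2, h3⟩ := key (c.sec (1, 0, 0, 0, 0, 0))
  simp at h1 h2 h3
  exact ⟨h1, h2, h3⟩

theorem derivation_y {r : L} (hx : c.x r = 0) (hu : c.u r = 0) :
    c.x (D r) = 0 ∧ c.u (D r) = 0 := by
  have key (p : L) : c.y ⁅D r, p⁆ = 0 := by
    have h : ⁅D r, p⁆ = D ⁅r, p⁆ - ⁅r, D p⁆ := by rw [D.apply_lie_eq_add]; abel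
    have h' := c.derivation_z D (r := ⁅r, p⁆) (by simp) (by simp) (by simp [*])
    simp only [h, map_sub, h']
    simp [hx, hu]
  have h1 := key (c.sec (0, 1, 0, 0, 0, 0))
  have h2 := key (c.sec (1, 0, 0, 0, 0, 0))
  simp at h1 h2
  exact ⟨h1, h2⟩

/-- The subspace `x = 0` is stable under a derivation: it is the set of the `r` for which
`⁅r, ·⁆` maps the subspace `x = u = y = 0` into the centre. -/
theorem derivation_u {r : L} (hx : c.x r = 0) : c.x (D r) = 0 := by
  set q := c.sec (0, 0, 0, 1, 0, 0)
  have h : ⁅D r, q⁆ = D ⁅r, q⁆ - ⁅r, D q⁆ := by rw [D.apply_lie_eq_add]; abel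
  have h' := c.derivation_w D (r := ⁅r, q⁆) (by simp) (by simp) (by simp [hx, q]) (by simp [hx, q])
    (by simp [hx, q])
  have hq := c.derivation_z D (r := q) (by simp [q]) (by simp [q]) (by simp [q])
  have h1 := congrArg c.v h
  rw [map_sub, h'.2.2.2.2] at h1
  have hxq : c.x q = 0 := by simp [q]
  have hzq : c.z q = 1 := by simp [q]
  simpa [hx, hq, hxq, hzq] using h1

/-- If all derivations of `E` vanish, a derivation of `L` acts on the subquotients of the
coordinate filtration as multiplication by elements of `E`: the Leibniz rule for `⁅X e, U f⁆` shows that the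
failure of `E`-linearity is a derivation of `E`. The brackets `[U, V]` and `[X, U]` both reach `W`,
which gives the relation between the weights `α` of `X` and `β` of `U`. -/
theorem exists_weights (hE : ∀ δ : Derivation ℚ E E, δ = 0)
    (s : E) {k : ℚ} (hk : k ≠ 0) (hs : s * s = algebraMap ℚ E k) (hτ : τ s = -s) :
    ∃ α β : E, (∀ p, c.x (D p) = α * c.x p) ∧
      (∀ p, c.x p = 0 → c.u p = 0 → c.y (D p) = (α + β) * c.y p) ∧
      τ β = 2 * α + 2 * β := by
  -- the sections of the coordinates, and the maps induced by `D` on the subquotients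
  let X : E →ₗ[ℚ] L := c.sec ∘ₗ LinearMap.inl ℚ _ _
  let U : E →ₗ[ℚ] L := c.sec ∘ₗ LinearMap.inr ℚ _ _ ∘ₗ LinearMap.inl ℚ _ _
  let Y : E →ₗ[ℚ] L := c.sec ∘ₗ LinearMap.inr ℚ _ _ ∘ₗ LinearMap.inr ℚ _ _ ∘ₗ LinearMap.inl ℚ _ _
  let Z : E →ₗ[ℚ] L := c.sec ∘ₗ LinearMap.inr ℚ _ _ ∘ₗ LinearMap.inr ℚ _ _ ∘ₗ
    LinearMap.inr ℚ _ _ ∘ₗ LinearMap.inl ℚ _ _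
  let V : E →ₗ[ℚ] L := c.sec ∘ₗ LinearMap.inr ℚ _ _ ∘ₗ LinearMap.inr ℚ _ _ ∘ₗ
    LinearMap.inr ℚ _ _ ∘ₗ LinearMap.inr ℚ _ _ ∘ₗ LinearMap.inl ℚ _ _
  let W : E →ₗ[ℚ] L := c.sec ∘ₗ LinearMap.inr ℚ _ _ ∘ₗ LinearMap.inr ℚ _ _ ∘ₗ
    LinearMap.inr ℚ _ _ ∘ₗ LinearMap.inr ℚ _ _ ∘ₗ LinearMap.inr ℚ _ _
  let Dl : L →ₗ[ℚ] L := D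
  let dx : E →ₗ[ℚ] E := c.x ∘ₗ Dl ∘ₗ X
  let du : E →ₗ[ℚ] E := c.u ∘ₗ Dl ∘ₗ U
  let dy : E →ₗ[ℚ] E := c.y ∘ₗ Dl ∘ₗ Y
  let dz : E →ₗ[ℚ] E := c.z ∘ₗ Dl ∘ₗ Z
  let dv : E →ₗ[ℚ] E := c.v ∘ₗ Dl ∘ₗ V
  have hx (p : L) : c.x (D p) = dx (c.x p) := by
    have h := c.derivation_u D (r := p - X (c.x p)) (by simp [X])
    rwa [map_sub, map_sub, sub_eq_zero] at h
  have hu (p : L) (h0 : c.x p = 0) : c.u (D p) = du (c.u p) := by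
    have h := (c.derivation_y D (r := p - U (c.u p)) (by simp [U, *]) (by simp [U])).2
    rwa [map_sub, map_sub, sub_eq_zero] at h
  have hy (p : L) (h0 : c.x p = 0) (h1 : c.u p = 0) : c.y (D p) = dy (c.y p) := by
    have h := (c.derivation_z D (r := p - Y (c.y p)) (by simp [Y, *]) (by simp [Y, *])
      (by simp [Y])).2.2
    rwa [map_sub, map_sub, sub_eq_zero] at h
  have hz (p : L) (h0 : c.x p = 0) (h1 : c.u p = 0) (h2 : c.y p = 0) :
      c.z (D p) = dz (c.z p) := by
    have h := (c.derivation_v D (r := p - Z (c.z p)) (by simp [Z, *]) (by simp [Z, *])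
      (by simp [Z, *]) (by simp [Z])).2.2.2
    rwa [map_sub, map_sub, sub_eq_zero] at h
  have hv (p : L) (h0 : c.x p = 0) (h1 : c.u p = 0) (h2 : c.y p = 0) (h3 : c.z p = 0) :
      c.v (D p) = dv (c.v p) := by
    have h := (c.derivation_w D (r := p - V (c.v p)) (by simp [V, *]) (by simp [V, *])
      (by simp [V, *]) (by simp [V, *]) (by simp [V])).2.2.2.2
    rwa [map_sub, map_sub, sub_eq_zero] at h
  -- the Leibniz rule on the quotient by `x = u = 0` determines `dx`, `du` and `dy`
  have hdy (e f : E) : dy (e * f) = dx e * f + e * du f := by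
    have h := congrArg c.y (D.apply_lie_eq_add (X e) (U f))
    rw [hy _ (by simp) (by simp)] at h
    simpa [hx, hu, X, U, add_comm] using h
  have hdu (f : E) : du f = dx f + du 1 * f - dx 1 * f := by
    have h1 := hdy f 1
    have h2 := hdy 1 f
    rw [one_mul] at h2
    rw [mul_one, h2] at h1
    linear_combination h1
  have hdx (e : E) : dx e = dx 1 * e := by
    have h := hE (Derivation.mk' (dx - LinearMap.mulLeft ℚ (dx 1)) (fun e f => by
      have h1 := hdy e f
      have h2 := hdy 1 (e * f)
      rw [one_mul, h1, hdu f, hdu (e * f)] at h2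
      simp only [LinearMap.sub_apply, LinearMap.mulLeft_apply, smul_eq_mul]
      linear_combination -h2))
    have h' := DFunLike.congr_fun h e
    simpa [sub_eq_zero] using h'
  obtain ⟨α, hα⟩ : ∃ α, dx 1 = α := ⟨_, rfl⟩
  obtain ⟨β, hβ⟩ : ∃ β, du 1 = β := ⟨_, rfl⟩
  rw [hα] at hdx
  have hdu (e : E) : du e = β * e := by
    rw [hdu, hdx, hα, hβ]; ring
  have hdy (e : E) : dy e = (α + β) * e := by
    have h := hdy e 1
    rw [mul_one, hdx, hβ] at h
    linear_combination h
  have hdz (e : E) : dz e = (2 * α + β) * e := by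
    have h := congrArg c.z (D.apply_lie_eq_add (X 1) (Y e))
    have h0 := c.derivation_y D (r := Y e) (by simp [Y]) (by simp [Y])
    rw [hz _ (by simp) (by simp) (by simp [X, Y])] at h
    rw [map_add, c.z_lie, c.z_lie, c.z_lie, h0.1, hx, hy (Y e) (by simp [Y]) (by simp [Y]), hdx,
      hdy] at h
    simp [X, Y] at h
    linear_combination h
  have hdv (e : E) : dv e = (3 * α + β) * e := by
    have h := congrArg c.v (D.apply_lie_eq_add (X 1) (Z e))
    have h0 := c.derivation_z D (r := Z e) (by simp [Z]) (by simp [Z]) (by simp [Z])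
    rw [hv _ (by simp) (by simp) (by simp [X, Z]) (by simp [X, Z])] at h
    rw [map_add, c.v_lie, c.v_lie, c.v_lie, h0.1, hx, hz (Z e) (by simp [Z]) (by simp [Z])
      (by simp [Z]), hdx, hdz] at h
    simp [X, Z] at h
    linear_combination h
  have hdw (e : E) : c.w (D (W e)) = (3 * α + 2 * β) * e := by
    have h1 : ⁅U 1, V e⁆ = W e := by rw [c.lie_eq_sec]; simp [U, V, W]
    have h := congrArg c.w (D.apply_lie_eq_add (U 1) (V e))
    have h0 := c.derivation_v D (r := V e) (by simp [V]) (by simp [V]) (by simp [V]) (by simp [V])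
    rw [h1, map_add, c.w_lie, c.w_lie, h0.1, h0.2.1, h0.2.2.1, h0.2.2.2, hx, hu (U 1)
      (by simp [U]), hv (V e) (by simp [V]) (by simp [V])
      (by simp [V]) (by simp [V]), hdx, hdu, hdv] at h
    simp [U, V] at h
    linear_combination h
  -- the coordinate `w` of `D ⁅X e, U f⁆`: only the terms of weight `W` involve `e * τ f`
  have rel (e f : E) : c.w (D (Y (e * f))) + (3 * α + 2 * β) * (e * τ f) =
      -(f * c.v (D (X e))) + α * e * τ f + e * (τ β * τ f) := by
    have h1 : ⁅X e, U f⁆ = Y (e * f) + W (e * τ f) := by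
      rw [c.lie_eq_sec]; simp [X, U, Y, W, ← map_add]
    have h := congrArg c.w (D.apply_lie_eq_add (X e) (U f))
    have h0 := c.derivation_u D (r := U f) (by simp [U])
    have hX : c.x (X e) = e ∧ c.u (X e) = 0 ∧ c.y (X e) = 0 ∧ c.z (X e) = 0 ∧ c.v (X e) = 0 := by
      simp [X]
    have hU : c.x (U f) = 0 ∧ c.u (U f) = f ∧ c.y (U f) = 0 ∧ c.z (U f) = 0 ∧ c.v (U f) = 0 := by
      simp [U]
    rw [h1, map_add, map_add, hdw, map_add, c.w_lie, c.w_lie, h0, hx (X e),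
      hu (U f) hU.1, hdx, hdu] at h
    simp only [hX, hU, map_mul] at h
    linear_combination h
  refine ⟨α, β, fun p => by rw [hx, hdx], fun p h h' => by rw [hy p h h', hdy], ?_⟩
  -- `e * τ f` is independent of the functions `e * f`, `τ e * τ f`, `τ e * f` that occur in the
  -- terms with `c.w` and `c.v`; evaluating at `e, f ∈ {1, s}` isolates its coefficient
  have r1 := rel 1 1
  have r2 := rel s 1
  have r3 := rel 1 s
  have r4 := rel s s
  have hk1 : Y (s * s) = k • Y (1 * 1) := by
    rw [← map_smul, hs, Algebra.smul_def]; simp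
  have hk2 : c.w (D (Y (s * s))) = s * s * c.w (D (Y (1 * 1))) := by
    rw [hk1, map_smul, map_smul, Algebra.smul_def, hs]
  have hk' : s * s ≠ 0 := by
    rw [hs]; exact (map_ne_zero _).mpr hk
  rw [hk2, hτ] at r4
  rw [hτ] at r3
  simp only [mul_one, one_mul, map_one] at r1 r2 r3 r4
  have h2 : (4 : E) ≠ 0 := by
    have := algebraRat.charZero E
    norm_num
  have : 4 * (s * s) * (τ β - (2 * α + 2 * β)) = 0 := by
    linear_combination s * r3 + r4 - (s * s) * r1 - s * r2
  simpa [sub_eq_zero, h2, hk', left_ne_zero_of_mul hk'] using this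

/-- The weights `α`, `β` of `X`, `U` satisfy `τ β = 2 * α + 2 * β`. In a positive grading `α` is a
positive rational number, so `β = -2 * α`, and the weight `α + β` of `Y` is negative. -/
theorem not_hasPositiveGrading (c : TwistedCoordinates E τ L)
    (hE : ∀ δ : Derivation ℚ E E, δ = 0) (hττ : ∀ e, τ (τ e) = e)
    (s : E) {k : ℚ} (hk : k ≠ 0) (hs : s * s = algebraMap ℚ E k) (hτ : τ s = -s) :
    ¬ HasPositiveGrading ℚ L := by
  rintro ⟨N, hN, hlie⟩
  have := algebraRat.charZero E
  obtain ⟨D, hD⟩ := exists_lieDerivation_of_grading hN hlie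
  obtain ⟨α, β, hα, hαβ, hβ⟩ := c.exists_weights D hE s hk hs hτ
  have htop : ∀ p : L, p ∈ ⨆ i, N i := fun p => by
    rw [hN.submodule_iSup_eq_top]; trivial
  -- `α` is the degree of any homogeneous element on which `x` does not vanish
  obtain ⟨a, ha⟩ : ∃ a : ℕ+, α = (a : ℕ) := by
    by_contra! h
    have h0 (p : L) : c.x p = 0 := by
      refine Submodule.iSup_induction N (motive := fun p => c.x p = 0) (htop p)
        (fun i p hp => ?_) (by simp) (fun p q hp hq => by simp [hp, hq])
      have h1 := hα p
      rw [hD i p hp, map_smul, Algebra.smul_def, map_natCast] at h1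
      by_contra h2
      exact h i (mul_right_cancel₀ h2 h1).symm
    simpa using h0 (c.sec (1, 0, 0, 0, 0, 0))
  have hβ' : α + β = -(a : ℕ) := by
    have h := congrArg τ hβ
    rw [hττ, ha] at h
    simp only [map_add, map_mul, map_ofNat, map_natCast, hβ] at h
    rw [ha] at h ⊢
    have h3 : (3 : E) ≠ 0 := by norm_num
    apply mul_left_cancel₀ h3
    linear_combination -h
  -- brackets of homogeneous elements have positive degree, but weight `α + β < 0` in `y`
  have hyN (i j : ℕ+) (p q : L) (hp : p ∈ N i) (hq : q ∈ N j) : c.y ⁅p, q⁆ = 0 := by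
    have h := hαβ ⁅p, q⁆ (by simp) (by simp)
    rw [hD _ _ (hlie i j p hp q hq), map_smul, Algebra.smul_def, map_natCast, hβ'] at h
    have h1 : (((i + j : ℕ+) : ℕ) + (a : ℕ) : E) ≠ 0 := by
      exact_mod_cast (by positivity : ((i + j : ℕ+) : ℕ) + (a : ℕ) ≠ 0)
    have h2 : (((i + j : ℕ+) : ℕ) + (a : ℕ) : E) * c.y ⁅p, q⁆ = 0 := by linear_combination h
    exact (mul_eq_zero.mp h2).resolve_left h1
  have hy0 (p q : L) : c.y ⁅p, q⁆ = 0 := by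
    refine Submodule.iSup_induction N (motive := fun p => c.y ⁅p, q⁆ = 0) (htop p)
      (fun i p hp => ?_) (by simp) (fun p p' h h' => by rw [add_lie, map_add, h, h', add_zero])
    exact Submodule.iSup_induction N (motive := fun q => c.y ⁅p, q⁆ = 0) (htop q)
      (fun j q hq => hyN i j p q hp hq) (by simp)
      (fun q q' h h' => by rw [lie_add, map_add, h, h', add_zero])
  simpa using hy0 (c.sec (1, 0, 0, 0, 0, 0)) (c.sec (0, 1, 0, 0, 0, 0))

/-- A Lie algebra with twisted coordinates is nilpotent: each bracket kills one more coordinate. -/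
theorem isNilpotent [FiniteDimensional ℚ L] (c : TwistedCoordinates E τ L) :
    LieRing.IsNilpotent L := by
  rw [LieAlgebra.isNilpotent_iff_forall (R := ℚ)]
  intro p
  refine ⟨6, LinearMap.ext fun q => ?_⟩
  simp only [pow_succ', pow_zero, mul_one, Module.End.mul_apply, LieAlgebra.ad_apply,
    LinearMap.zero_apply]
  rw [← lie_skew, neg_eq_zero]
  apply c.lie_eq_zero_of_coords <;> simp

end TwistedCoordinates

/-! ### Characteristic polynomials -/

section

open Polynomial

/-- A monic quadratic polynomial is the minimal polynomial of each of its irrational roots. -/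
theorem minpoly_eq_of_natDegree_eq_two {K S : Type*} [Field K] [CommRing S] [IsDomain S]
    [Algebra K S] {r : S} {p : K[X]} (hp : p.Monic) (hdeg : p.natDegree = 2)
    (hr : aeval r p = 0) (hmem : r ∉ (algebraMap K S).range) : minpoly K r = p := by
  have hint : IsIntegral K r := ⟨p, hp, hr⟩
  refine (Polynomial.eq_of_monic_of_dvd_of_natDegree_le (minpoly.monic hint) hp
    (minpoly.dvd K r hr) ?_).symm
  rw [hdeg]
  exact (minpoly.two_le_natDegree_iff hint).mpr hmem

theorem charpoly_mulLeft_eq_minpoly {K S : Type*} [Field K] [CommRing S] [Algebra K S]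
    [FiniteDimensional K S] {r : S}
    (h : (minpoly K r).natDegree = Module.finrank K S) :
    (LinearMap.mulLeft K r).charpoly = minpoly K r := by
  have h1 : minpoly K (LinearMap.mulLeft K r) = minpoly K r :=
    minpoly.algHom_eq (Algebra.lmul K S) Algebra.lmul_injective r
  have h2 := LinearMap.minpoly_dvd_charpoly (LinearMap.mulLeft K r)
  rw [h1] at h2
  refine Polynomial.eq_of_monic_of_dvd_of_natDegree_le
    (minpoly.monic (Algebra.IsIntegral.isIntegral r)) (LinearMap.charpoly_monic _) h2 ?_
  rw [h, LinearMap.charpoly_natDegree]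

/-- Hyperbolic and integer-like endomorphisms of a finite-dimensional rational vector space. -/
def IsAnosovMap {V : Type*} [AddCommGroup V] [Module ℚ V] [FiniteDimensional ℚ V]
    (A : V →ₗ[ℚ] V) : Prop :=
  IsHyperbolic A ∧ IsIntegerLike A

theorem IsAnosovMap.prodMap {V W : Type*} [AddCommGroup V] [Module ℚ V] [FiniteDimensional ℚ V]
    [AddCommGroup W] [Module ℚ W] [FiniteDimensional ℚ W] {A : V →ₗ[ℚ] V} {B : W →ₗ[ℚ] W}
    (hA : IsAnosovMap A) (hB : IsAnosovMap B) : IsAnosovMap (A.prodMap B) := by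
  obtain ⟨hA, ⟨p, hp⟩, hdA⟩ := hA
  obtain ⟨hB, ⟨q, hq⟩, hdB⟩ := hB
  refine ⟨fun z hz => ?_, ⟨p * q, ?_⟩, ?_⟩
  · rw [LinearMap.charpoly_prodMap, map_mul, mul_eq_zero] at hz
    exact hz.elim (hA z) (hB z)
  · rw [LinearMap.charpoly_prodMap, hp, hq, Polynomial.map_mul]
  · rw [LinearMap.det_prodMap]
    rcases hdA with h | h <;> rcases hdB with h' | h' <;> simp [h, h']

theorem IsAnosovMap.conj {V W : Type*} [AddCommGroup V] [Module ℚ V] [FiniteDimensional ℚ V]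
    [AddCommGroup W] [Module ℚ W] [FiniteDimensional ℚ W] {A : V →ₗ[ℚ] V}
    (hA : IsAnosovMap A) (e : V ≃ₗ[ℚ] W) : IsAnosovMap (e.conj A) := by
  obtain ⟨hA, hA', hd⟩ := hA
  refine ⟨?_, ?_, ?_⟩
  · rwa [IsHyperbolic, LinearEquiv.charpoly_conj]
  · rwa [LinearEquiv.charpoly_conj]
  · rwa [LinearEquiv.conj_apply, LinearMap.comp_assoc, LinearMap.det_conj]

/-- Multiplication by a generator is an Anosov map when the minimal polynomial is integral with
constant term `1` and has no root on the unit circle. -/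
theorem isAnosovMap_mulLeft {S : Type*} [CommRing S] [Algebra ℚ S]
    [FiniteDimensional ℚ S] {r : S} (p : ℤ[X])
    (hp : minpoly ℚ r = p.map (Int.castRingHom ℚ))
    (hdeg : (minpoly ℚ r).natDegree = Module.finrank ℚ S)
    (h0 : p.coeff 0 = 1) (hz : ∀ z : ℂ, aeval z p = 0 → ‖z‖ ≠ 1) :
    IsAnosovMap (LinearMap.mulLeft ℚ r) := by
  have hc : (LinearMap.mulLeft ℚ r).charpoly = p.map (Int.castRingHom ℚ) :=
    (charpoly_mulLeft_eq_minpoly hdeg).trans hp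
  refine ⟨fun z h => hz z ?_, ⟨p, hc⟩, ?_⟩
  · rwa [hc, ← algebraMap_int_eq, aeval_map_algebraMap] at h
  · rw [LinearMap.det_eq_sign_charpoly_coeff, hc, coeff_map, h0]
    simpa using neg_one_pow_eq_or ℚ _

/-! ### The abelian summand -/

/-- In dimension `d + 2` a map with characteristic polynomial `X ^ (d + 2) - 3 X ^ (d + 1) + 1`
is Anosov: on the unit circle the middle term dominates the other two. -/
theorem exists_isAnosovMap_pi (d : ℕ) :
    ∃ B : (Fin (d + 2) → ℚ) ≃ₗ[ℚ] (Fin (d + 2) → ℚ), IsAnosovMap B.toLinearMap := by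
  let p : ℤ[X] := X ^ (d + 2) - C 3 * X ^ (d + 1) + 1
  have hpn : p.natDegree = d + 2 := by simp only [p]; compute_degree!
  have hpm : p.Monic := by simp only [p]; monicity!
  let q : ℚ[X] := p.map (Int.castRingHom ℚ)
  have hqm : q.Monic := hpm.map _
  have hqn : q.natDegree = d + 2 := by rw [hpm.natDegree_map, hpn]
  let pb := AdjoinRoot.powerBasis hqm.ne_zero
  have : FiniteDimensional ℚ (AdjoinRoot q) := pb.finite
  have hfin : Module.finrank ℚ (AdjoinRoot q) = d + 2 := by
    rw [pb.finrank, AdjoinRoot.powerBasis_dim, hqn]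
  have hmin : minpoly ℚ (AdjoinRoot.root q) = q := by
    rw [AdjoinRoot.minpoly_root hqm.ne_zero, hqm.leadingCoeff]; simp
  have hA : IsAnosovMap (LinearMap.mulLeft ℚ (AdjoinRoot.root q)) := by
    refine isAnosovMap_mulLeft p hmin (by rw [hmin, hqn, hfin]) (by simp [p]) fun z hz h1 => ?_
    have h2 : 3 * z ^ (d + 1) = z ^ (d + 2) + 1 := by
      simp only [p, map_add, map_sub, map_mul, map_pow, aeval_X, map_one, map_ofNat] at hz
      linear_combination -hz
    have h3 := congrArg norm h2
    have h4 := norm_add_le (z ^ (d + 2)) 1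
    rw [← h3] at h4
    simp [h1] at h4
    norm_num at h4
  let e : AdjoinRoot q ≃ₗ[ℚ] (Fin (d + 2) → ℚ) :=
    LinearEquiv.ofFinrankEq _ _ (by simp [hfin])
  have hB := hA.conj e
  have hdet : IsUnit (LinearMap.det (e.conj (LinearMap.mulLeft ℚ (AdjoinRoot.root q)))) := by
    rcases hB.2.2 with h | h <;> simp [h]
  refine ⟨LinearEquiv.ofIsUnitDet (v := Pi.basisFun ℚ _) (v' := Pi.basisFun ℚ _)
    (f := e.conj (LinearMap.mulLeft ℚ (AdjoinRoot.root q))) ?_, ?_⟩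
  · rwa [LinearMap.det_toMatrix]
  · exact hB

end

namespace TwelveDim

open Polynomial

/-! ### The quadratic field -/

/-- The square root of `k` as an element of `ℚ(√k)`. -/
noncomputable def sqrtGen (k : ℕ) : quadField k := IntermediateField.AdjoinSimple.gen ℚ (√(k : ℝ))

theorem coe_sqrtGen (k : ℕ) : (sqrtGen k : ℝ) = √(k : ℝ) :=
  IntermediateField.AdjoinSimple.coe_gen ℚ _

theorem sqrtGen_mul_self (k : ℕ) : sqrtGen k * sqrtGen k = k := by
  apply Subtype.ext
  simp [coe_sqrtGen]

variable {k : ℕ}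

theorem minpoly_sqrt (hk : ¬ IsSquare k) : minpoly ℚ (√(k : ℝ)) = X ^ 2 - C (k : ℚ) := by
  refine minpoly_eq_of_natDegree_eq_two (by monicity!) (by compute_degree!) (by simp) ?_
  rintro ⟨a, ha⟩
  exact irrational_sqrt_natCast_iff.mpr hk ⟨a, ha⟩

theorem isIntegral_sqrt (k : ℕ) : IsIntegral ℚ (√(k : ℝ)) :=
  ⟨X ^ 2 - C (k : ℚ), by monicity!, by simp⟩

instance : FiniteDimensional ℚ (quadField k) :=
  IntermediateField.adjoin.finiteDimensional (isIntegral_sqrt k)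

theorem finrank_quadField (hk : ¬ IsSquare k) : Module.finrank ℚ (quadField k) = 2 := by
  rw [IntermediateField.adjoin.finrank (isIntegral_sqrt k), minpoly_sqrt hk]
  compute_degree!

theorem algHom_ext {F : Type*} [Field F] [Algebra ℚ F] {f g : quadField k →ₐ[ℚ] F}
    (h : f (sqrtGen k) = g (sqrtGen k)) : f = g :=
  (IntermediateField.adjoin.powerBasis (isIntegral_sqrt k)).algHom_ext (by
    rw [IntermediateField.adjoin.powerBasis_gen]; exact h)

theorem exists_conj (hk : ¬ IsSquare k) :
    ∃ τ : quadField k ≃ₐ[ℚ] quadField k, τ (sqrtGen k) = -sqrtGen k ∧ (∀ e, τ (τ e) = e) := by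
  let f : quadField k →ₐ[ℚ] quadField k :=
    (IntermediateField.algHomAdjoinIntegralEquiv ℚ (isIntegral_sqrt k)).symm ⟨-sqrtGen k, by
      rw [minpoly_sqrt hk, mem_aroots]
      exact ⟨(by monicity! : (X ^ 2 - C (k : ℚ)).Monic).ne_zero,
        by simp [pow_two, sqrtGen_mul_self]⟩⟩
  have hf : f (sqrtGen k) = -sqrtGen k :=
    IntermediateField.algHomAdjoinIntegralEquiv_symm_apply_gen ℚ (isIntegral_sqrt k) _
  have hff : f.comp f = AlgHom.id ℚ _ := algHom_ext (by simp [hf])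
  exact ⟨AlgEquiv.ofAlgHom f f hff hff, hf, fun e => DFunLike.congr_fun hff e⟩

theorem sqrtGen_ne_zero (hk : ¬ IsSquare k) : sqrtGen k ≠ 0 := by
  intro h
  have h1 := sqrtGen_mul_self k
  rw [h, zero_mul, eq_comm, Nat.cast_eq_zero] at h1
  exact hk (h1 ▸ ⟨0, rfl⟩)

/-- The Galois group of `ℚ(√k)` consists of the identity and the conjugation `τ`. -/
theorem eq_one_or_eq_conj {τ : quadField k ≃ₐ[ℚ] quadField k} (hτ : τ (sqrtGen k) = -sqrtGen k)
    (σ : quadField k ≃ₐ[ℚ] quadField k) : σ = 1 ∨ σ = τ := by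
  have h := congrArg σ (sqrtGen_mul_self k)
  rw [map_mul, map_natCast, ← sqrtGen_mul_self k, mul_self_eq_mul_self_iff] at h
  have ext {σ σ' : quadField k ≃ₐ[ℚ] quadField k} (h : σ (sqrtGen k) = σ' (sqrtGen k)) :
      σ = σ' := by
    have := algHom_ext (f := (σ : quadField k →ₐ[ℚ] quadField k)) (g := σ') h
    exact AlgEquiv.ext fun e => DFunLike.congr_fun this e
  exact h.imp (fun h => ext h) (fun h => ext (h.trans hτ.symm))

theorem conj_ne_one (hk : ¬ IsSquare k) {τ : quadField k ≃ₐ[ℚ] quadField k}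
    (hτ : τ (sqrtGen k) = -sqrtGen k) : τ ≠ 1 := by
  rintro rfl
  exact sqrtGen_ne_zero hk (self_eq_neg.mp hτ)

theorem derivation_quadField_eq_zero (δ : Derivation ℚ (quadField k) (quadField k)) : δ = 0 := by
  have : Subsingleton (Derivation ℚ (quadField k) (quadField k)) := by
    have := Algebra.FormallyUnramified.of_isSeparable ℚ (quadField k)
    exact (KaehlerDifferential.linearMapEquivDerivation ℚ (quadField k)).symm.injective.subsingleton
  exact Subsingleton.elim _ _

/-! ### Pell units -/

/-- The unit `x + y √k` of norm `1` attached to a solution of `x ^ 2 - k y ^ 2 = 1`. -/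
noncomputable def pellUnit (k : ℕ) : Pell.Solution₁ (k : ℤ) →* quadField k where
  toFun a := a.x + a.y * sqrtGen k
  map_one' := by simp
  map_mul' a b := by
    simp only [Pell.Solution₁.x_mul, Pell.Solution₁.y_mul]
    push_cast
    linear_combination -(a.y * b.y : quadField k) * sqrtGen_mul_self k

theorem pellUnit_apply (a : Pell.Solution₁ (k : ℤ)) :
    pellUnit k a = a.x + a.y * sqrtGen k := rfl

theorem conj_pellUnit {τ : quadField k ≃ₐ[ℚ] quadField k} (hτ : τ (sqrtGen k) = -sqrtGen k)
    (a : Pell.Solution₁ (k : ℤ)) : τ (pellUnit k a) = pellUnit k a⁻¹ := by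
  simp [pellUnit_apply, hτ]

theorem isAnosovMap_mulLeft_pellUnit (hk : ¬ IsSquare k) {a : Pell.Solution₁ (k : ℤ)}
    (ha : a.y ≠ 0) : IsAnosovMap (LinearMap.mulLeft ℚ (pellUnit k a)) := by
  obtain ⟨m, hm⟩ : ∃ m, m = 2 * a.x := ⟨_, rfl⟩
  let p : ℤ[X] := X ^ 2 - C m * X + 1
  have hpn : p.natDegree = 2 := by simp only [p]; compute_degree!
  have hpm : p.Monic := by simp only [p]; monicity!
  have hmin : minpoly ℚ (pellUnit k a) = p.map (Int.castRingHom ℚ) := by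
    refine minpoly_eq_of_natDegree_eq_two (hpm.map _) (by rw [hpm.natDegree_map, hpn]) ?_ ?_
    · have h : (a.x : quadField k) ^ 2 - k * (a.y : quadField k) ^ 2 = 1 := by
        exact_mod_cast congrArg (Int.cast : ℤ → quadField k) a.prop
      rw [← algebraMap_int_eq, aeval_map_algebraMap]
      simp only [p, map_add, map_sub, map_mul, map_pow, aeval_X, map_one, pellUnit_apply,
        eq_intCast, map_intCast, hm]
      push_cast
      linear_combination (a.y : quadField k) ^ 2 * sqrtGen_mul_self k - h
    · rintro ⟨r, hr⟩
      have h := congrArg (algebraMap (quadField k) ℝ) hr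
      have h1 := (irrational_sqrt_natCast_iff.mpr hk).intCast_mul ha |>.intCast_add a.x
      refine h1 ⟨r, ?_⟩
      simpa [pellUnit_apply, coe_sqrtGen] using h
  refine isAnosovMap_mulLeft p hmin (by rw [hmin, hpm.natDegree_map, hpn, finrank_quadField hk])
    (by simp [p]) fun z hz h1 => ?_
  -- on the unit circle `|2 x| = |z ^ 2 + 1| ≤ 2`, whereas `x ^ 2 = 1 + k y ^ 2 > 1`
  have h2 : (m : ℂ) * z = z ^ 2 + 1 := by
    simp only [p, map_add, map_sub, map_mul, map_pow, aeval_X, map_one,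
      eq_intCast, map_intCast] at hz
    linear_combination -hz
  have h4 := norm_add_le (z ^ 2) 1
  rw [← h2, norm_mul, norm_pow, h1, Complex.norm_intCast] at h4
  have h5 : |a.x| ≤ 1 := by
    rw [hm] at h4
    push_cast at h4
    rw [abs_mul] at h4
    have : |(a.x : ℝ)| ≤ 1 := by norm_num at h4; linarith
    exact_mod_cast this
  have h6 : 0 < (k : ℤ) * a.y ^ 2 := by
    have hk0 : k ≠ 0 := fun h => hk (h ▸ ⟨0, rfl⟩)
    positivity
  have h7 := (sq_le_one_iff_abs_le_one a.x).mpr h5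
  linarith [a.prop]

/-! ### The rational form in coordinates -/

/-- The rational form is cut out by the single condition that exchanging the two basis vectors of
each pair conjugates the coordinates. -/
theorem mem_mLie_iff (hk : ¬ IsSquare k) {τ : quadField k ≃ₐ[ℚ] quadField k}
    (hτ : τ (sqrtGen k) = -sqrtGen k) (v : NLie (quadField k)) :
    v ∈ mLie k ↔ ∀ i, v (swapIdx i) = τ (v i) := by
  constructor
  · intro h i
    have h1 := h τ
    rw [rho, if_neg (conj_ne_one hk hτ)] at h1
    exact congrFun h1 i
  · intro h σ
    rcases eq_one_or_eq_conj hτ σ with rfl | rfl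
    · simp only [rho, if_true]
      rfl
    · rw [rho, if_neg (conj_ne_one hk hτ)]
      exact NLie.ext h

/-- A coordinate function on the rational form. -/
def coord (k : ℕ) (i : Idx) : mLie k →ₗ[ℚ] quadField k where
  toFun v := (v : NLie (quadField k)) i
  map_add' _ _ := rfl
  map_smul' _ _ := rfl

theorem coord_apply (i : Idx) (v : mLie k) : coord k i v = (v : NLie (quadField k)) i := rfl

/-- The element of `𝔫` with given coordinates along `X1`, `X3`, `Y1`, `Z1`, `V1`, `W1`, the other
six coordinates being their conjugates. -/
noncomputable def ofCoords (τ : quadField k ≃ₐ[ℚ] quadField k)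
    (a : quadField k × quadField k × quadField k × quadField k × quadField k × quadField k) :
    NLie (quadField k)
  | .X1 => a.1
  | .X2 => τ a.1
  | .X3 => a.2.1
  | .X4 => τ a.2.1
  | .Y1 => a.2.2.1
  | .Y2 => τ a.2.2.1
  | .Z1 => a.2.2.2.1
  | .Z2 => τ a.2.2.2.1
  | .V1 => a.2.2.2.2.1
  | .V2 => τ a.2.2.2.2.1
  | .W1 => a.2.2.2.2.2
  | .W2 => τ a.2.2.2.2.2

theorem ofCoords_mem (hk : ¬ IsSquare k) {τ : quadField k ≃ₐ[ℚ] quadField k}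
    (hτ : τ (sqrtGen k) = -sqrtGen k) (hττ : ∀ e, τ (τ e) = e)
    (a : quadField k × quadField k × quadField k × quadField k × quadField k × quadField k) :
    ofCoords τ a ∈ mLie k := by
  rw [mem_mLie_iff hk hτ]
  intro i
  cases i <;> simp [swapIdx, ofCoords, hττ]

/-- An element of the rational form is determined by its coordinates along `X1`, `X3`, `Y1`, `Z1`,
`V1`, `W1`, which are arbitrary elements of `ℚ(√k)`. -/
noncomputable def coordEquiv (hk : ¬ IsSquare k) {τ : quadField k ≃ₐ[ℚ] quadField k}
    (hτ : τ (sqrtGen k) = -sqrtGen k) (hττ : ∀ e, τ (τ e) = e) :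
    mLie k ≃ₗ[ℚ] (quadField k × quadField k × quadField k × quadField k × quadField k ×
      quadField k) :=
  LinearEquiv.ofLinearMap
    ((coord k .X1).prod ((coord k .X3).prod ((coord k .Y1).prod ((coord k .Z1).prod
      ((coord k .V1).prod (coord k .W1))))))
    { toFun := fun a => ⟨ofCoords τ a, ofCoords_mem hk hτ hττ a⟩
      map_add' := fun a b => Subtype.ext (NLie.ext fun i => by
        cases i <;> first | rfl | exact map_add τ _ _)
      map_smul' := fun c b => Subtype.ext (NLie.ext fun i => by
        cases i <;> first | rfl | exact τ.toLinearMap.map_smul c _) }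
    (LinearMap.ext fun a => rfl)
    (LinearMap.ext fun v => by
      have h := (mem_mLie_iff hk hτ v.1).mp v.2
      apply Subtype.ext
      ext1 i
      cases i
      case X1 | X3 | Y1 | Z1 | V1 | W1 => rfl
      · exact (h .X1).symm
      · exact (h .X3).symm
      · exact (h .Y1).symm
      · exact (h .Z1).symm
      · exact (h .V1).symm
      · exact (h .W1).symm)

theorem coordEquiv_apply (hk : ¬ IsSquare k) {τ : quadField k ≃ₐ[ℚ] quadField k}
    (hτ : τ (sqrtGen k) = -sqrtGen k) (hττ : ∀ e, τ (τ e) = e) (v : mLie k) :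
    coordEquiv hk hτ hττ v = (coord k .X1 v, coord k .X3 v, coord k .Y1 v, coord k .Z1 v,
      coord k .V1 v, coord k .W1 v) := rfl

theorem finiteDimensional_mLie (hk : ¬ IsSquare k) : FiniteDimensional ℚ (mLie k) := by
  obtain ⟨τ, hτ, hττ⟩ := exists_conj hk
  exact (coordEquiv hk hτ hττ).symm.finiteDimensional

theorem finrank_mLie (hk : ¬ IsSquare k) : Module.finrank ℚ (mLie k) = 12 := by
  obtain ⟨τ, hτ, hττ⟩ := exists_conj hk
  rw [(coordEquiv hk hτ hττ).finrank_eq]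
  simp [Module.finrank_prod, finrank_quadField hk]

theorem coe_fst_lie {d : ℕ} (p q : mLie k × AbelianLie d) :
    (⁅p, q⁆.1 : NLie (quadField k)) = NLie.bracket p.1 q.1 := rfl

/-- The sum of the rational form and an abelian Lie algebra has twisted coordinates, the ones along
`X1`, `X3`, `Y1`, `Z1`, `V1`, `W1`. The twist arises because the coordinate along `X4` is the
conjugate of the one along `X3`. -/
noncomputable def twistedCoordinates (hk : ¬ IsSquare k) {τ : quadField k ≃ₐ[ℚ] quadField k}
    (hτ : τ (sqrtGen k) = -sqrtGen k) (hττ : ∀ e, τ (τ e) = e) (d : ℕ) :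
    TwistedCoordinates (quadField k) τ (mLie k × AbelianLie d) where
  x := coord k .X1 ∘ₗ LinearMap.fst ℚ _ _
  u := coord k .X3 ∘ₗ LinearMap.fst ℚ _ _
  y := coord k .Y1 ∘ₗ LinearMap.fst ℚ _ _
  z := coord k .Z1 ∘ₗ LinearMap.fst ℚ _ _
  v := coord k .V1 ∘ₗ LinearMap.fst ℚ _ _
  w := coord k .W1 ∘ₗ LinearMap.fst ℚ _ _
  x_lie _ _ := rfl
  u_lie _ _ := rfl
  y_lie p q := by
    simp only [LinearMap.comp_apply, LinearMap.fst_apply, coord_apply, coe_fst_lie,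
      NLie.bracket, NLie.minor]
    ring
  z_lie p q := by
    simp only [LinearMap.comp_apply, LinearMap.fst_apply, coord_apply, coe_fst_lie,
      NLie.bracket, NLie.minor]
    ring
  v_lie p q := by
    simp only [LinearMap.comp_apply, LinearMap.fst_apply, coord_apply, coe_fst_lie,
      NLie.bracket, NLie.minor]
    ring
  w_lie p q := by
    have hp := (mem_mLie_iff hk hτ p.1.1).mp p.1.2 .X3
    have hq := (mem_mLie_iff hk hτ q.1.1).mp q.1.2 .X3
    simp only [LinearMap.comp_apply, LinearMap.fst_apply, coord_apply, coe_fst_lie,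
      NLie.bracket, NLie.minor, ← hp, ← hq, swapIdx]
    ring
  sec := LinearMap.inl ℚ _ _ ∘ₗ (coordEquiv hk hτ hττ).symm.toLinearMap
  x_sec _ := rfl
  u_sec _ := rfl
  y_sec _ := rfl
  z_sec _ := rfl
  v_sec _ := rfl
  w_sec _ := rfl
  lie_eq_sec p q := by
    refine Prod.ext ?_ rfl
    refine ((LinearEquiv.symm_apply_eq _).mpr ?_).symm
    rfl

/-! ### The Anosov automorphism -/

/-- The exponents of the fundamental unit in the diagonal Anosov automorphism. They add up along
every nonzero bracket of basis vectors, and change sign under `swapIdx`. -/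
def weight : Idx → ℤ
  | .X1 => 3
  | .X2 => -3
  | .X3 => -2
  | .X4 => 2
  | .Y1 => 1
  | .Y2 => -1
  | .Z1 => 4
  | .Z2 => -4
  | .V1 => 7
  | .V2 => -7
  | .W1 => 5
  | .W2 => -5

theorem exists_diagonal_lieEquiv (hk : ¬ IsSquare k) (a : Pell.Solution₁ (k : ℤ)) :
    ∃ A : mLie k ≃ₗ⁅ℚ⁆ mLie k, ∀ v i,
      coord k i (A v) = pellUnit k (a ^ weight i) * coord k i v := by
  obtain ⟨τ, hτ, -⟩ := exists_conj hk
  let S (b : Pell.Solution₁ (k : ℤ)) (v : mLie k) : mLie k :=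
    ⟨fun i => pellUnit k (b ^ weight i) * v.1 i, (mem_mLie_iff hk hτ _).mpr fun i => by
      have hw : weight (swapIdx i) = -weight i := by cases i <;> rfl
      change pellUnit k (b ^ weight (swapIdx i)) * (v : NLie (quadField k)) (swapIdx i) =
        τ (pellUnit k (b ^ weight i) * (v : NLie (quadField k)) i)
      rw [map_mul, conj_pellUnit hτ, ← zpow_neg, ← hw, (mem_mLie_iff hk hτ v.1).mp v.2]⟩
  have hS (b b' : Pell.Solution₁ (k : ℤ)) (h : b * b' = 1) (v : mLie k) : S b (S b' v) = v := by
    apply Subtype.ext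
    ext1 i
    change pellUnit k (b ^ weight i) * (pellUnit k (b' ^ weight i) * v.1 i) = v.1 i
    rw [← mul_assoc, ← map_mul, ← mul_zpow, h, one_zpow, map_one, one_mul]
  refine ⟨{ toFun := S a, invFun := S a⁻¹, map_add' := fun v w => ?_, map_smul' := fun c v => ?_,
            map_lie' := fun {v w} => ?_, left_inv := hS _ _ (inv_mul_cancel a),
            right_inv := hS _ _ (mul_inv_cancel a) }, fun v i => rfl⟩
  · apply Subtype.ext
    ext1 i
    exact mul_add _ _ _
  · apply Subtype.ext
    ext1 i
    exact mul_smul_comm c _ (v.1 i)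
  · have key (i j l : Idx) (h : weight l = weight i + weight j) :
        pellUnit k (a ^ weight l) * NLie.minor v.1 w.1 i j =
          NLie.minor (S a v).1 (S a w).1 i j := by
      rw [h, zpow_add, map_mul]
      change _ = pellUnit k (a ^ weight i) * v.1 i * (pellUnit k (a ^ weight j) * w.1 j) -
        pellUnit k (a ^ weight j) * v.1 j * (pellUnit k (a ^ weight i) * w.1 i)
      rw [NLie.minor]
      ring
    apply Subtype.ext
    ext1 i
    change pellUnit k (a ^ weight i) * NLie.bracket v.1 w.1 i =
      NLie.bracket (S a v).1 (S a w).1 i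
    cases i <;> simp only [NLie.bracket, mul_zero, mul_add] <;>
      simp only [key _ _ _ (show weight .Y1 = weight .X1 + weight .X3 from rfl),
        key _ _ _ (show weight .Y2 = weight .X2 + weight .X4 from rfl),
        key _ _ _ (show weight .Z1 = weight .X1 + weight .Y1 from rfl),
        key _ _ _ (show weight .Z2 = weight .X2 + weight .Y2 from rfl),
        key _ _ _ (show weight .V1 = weight .X1 + weight .Z1 from rfl),
        key _ _ _ (show weight .V2 = weight .X2 + weight .Z2 from rfl),
        key _ _ _ (show weight .W1 = weight .X3 + weight .V1 from rfl),
        key _ _ _ (show weight .W1 = weight .Z1 + weight .Y1 from rfl),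
        key _ _ _ (show weight .W1 = weight .X1 + weight .X4 from rfl),
        key _ _ _ (show weight .W2 = weight .X4 + weight .V2 from rfl),
        key _ _ _ (show weight .W2 = weight .Z2 + weight .Y2 from rfl),
        key _ _ _ (show weight .W2 = weight .X2 + weight .X3 from rfl)]

theorem exists_isAnosovMap_mLie (hk : ¬ IsSquare k) [FiniteDimensional ℚ (mLie k)] :
    ∃ A : mLie k ≃ₗ⁅ℚ⁆ mLie k, IsAnosovMap (A : mLie k →ₗ[ℚ] mLie k) := by
  obtain ⟨τ, hτ, hττ⟩ := exists_conj hk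
  have hk0 : k ≠ 0 := fun h => hk (h ▸ ⟨0, rfl⟩)
  have hkz : ¬ IsSquare (k : ℤ) := by rwa [Int.isSquare_natCast_iff]
  obtain ⟨a, ha⟩ := Pell.IsFundamental.exists_of_not_isSquare (by positivity) hkz
  have hy (n : ℤ) (hn : n ≠ 0) : (a ^ n).y ≠ 0 := by
    rw [Ne, ← Pell.Solution₁.eq_one_or_neg_one_iff_y_eq_zero, not_or]
    refine ⟨mt (ha.zpow_eq_one_iff n).mp hn, ?_⟩
    simpa using ha.zpow_ne_neg_zpow (n := n) (n' := 0)
  obtain ⟨A, hA⟩ := exists_diagonal_lieEquiv hk a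
  refine ⟨A, ?_⟩
  let M (i : Idx) : quadField k →ₗ[ℚ] quadField k := LinearMap.mulLeft ℚ (pellUnit k (a ^ weight i))
  have hM (i : Idx) : IsAnosovMap (M i) :=
    isAnosovMap_mulLeft_pellUnit hk (hy _ (by cases i <;> decide))
  have h := ((hM .X1).prodMap ((hM .X3).prodMap ((hM .Y1).prodMap ((hM .Z1).prodMap
    ((hM .V1).prodMap (hM .W1)))))).conj (coordEquiv hk hτ hττ).symm
  convert h using 1
  ext1 v
  rw [LinearEquiv.conj_apply_apply, LinearEquiv.eq_symm_apply]
  simp only [LinearEquiv.symm_symm, coordEquiv_apply, LinearMap.prodMap_apply]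
  simp [hA, M]

end TwelveDim

theorem finrank_abelianLie (d : ℕ) : Module.finrank ℚ (AbelianLie d) = d :=
  Module.finrank_fin_fun ℚ

instance (d : ℕ) : FiniteDimensional ℚ (AbelianLie d) :=
  inferInstanceAs (FiniteDimensional ℚ (Fin d → ℚ))

open TwelveDim in
theorem isAnosovLieAlgebra_mLie_prod {k : ℕ} (hk : ¬ IsSquare k) (d : ℕ) :
    IsAnosovLieAlgebra (mLie k × AbelianLie (d + 2)) := by
  obtain ⟨τ, hτ, hττ⟩ := exists_conj hk
  have := finiteDimensional_mLie hk
  obtain ⟨A, hA⟩ := exists_isAnosovMap_mLie hk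
  obtain ⟨B, hB⟩ := exists_isAnosovMap_pi d
  let B' : AbelianLie (d + 2) ≃ₗ[ℚ] AbelianLie (d + 2) := B
  refine ⟨(twistedCoordinates hk hτ hττ (d + 2)).isNilpotent, inferInstance,
    { A.toLinearEquiv.prodCongr B' with
      map_lie' := fun {p q} => Prod.ext (A.map_lie p.1 q.1) (map_zero B') }, ?_⟩
  exact hA.prodMap (W := AbelianLie (d + 2)) (B := B'.toLinearMap) hB

open TwelveDim in
theorem not_hasPositiveGrading_mLie_prod {k : ℕ} (hk : ¬ IsSquare k) (d : ℕ) :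
    ¬ HasPositiveGrading ℚ (mLie k × AbelianLie d) := by
  obtain ⟨τ, hτ, hττ⟩ := exists_conj hk
  have hk0 : (k : ℚ) ≠ 0 := Nat.cast_ne_zero.mpr fun h => hk (h ▸ ⟨0, rfl⟩)
  exact (twistedCoordinates hk hτ hττ d).not_hasPositiveGrading derivation_quadField_eq_zero hττ
    (sqrtGen k) hk0 (by simp [sqrtGen_mul_self]) hτ

theorem mainTheorem5 (n : ℕ) (hn : 14 ≤ n) :
    (∃ (L : Type) (_ : LieRing L) (_ : LieAlgebra ℚ L),
      Module.finrank ℚ L = n ∧ IsAnosovLieAlgebra L ∧ ¬ HasPositiveGrading ℚ L) ∧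
    ∀ k : ℕ, 0 < k → ¬ IsSquare k →
      Module.finrank ℚ (TwelveDim.mLie k × AbelianLie (n - 12)) = n ∧
      IsAnosovLieAlgebra (TwelveDim.mLie k × AbelianLie (n - 12)) ∧
      ¬ HasPositiveGrading ℚ (TwelveDim.mLie k × AbelianLie (n - 12)) := by
  have main : ∀ k : ℕ, 0 < k → ¬ IsSquare k →
      Module.finrank ℚ (TwelveDim.mLie k × AbelianLie (n - 12)) = n ∧
      IsAnosovLieAlgebra (TwelveDim.mLie k × AbelianLie (n - 12)) ∧
      ¬ HasPositiveGrading ℚ (TwelveDim.mLie k × AbelianLie (n - 12)) := by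
    intro k _ hk
    have := TwelveDim.finiteDimensional_mLie hk
    refine ⟨?_, ?_, not_hasPositiveGrading_mLie_prod hk _⟩
    · rw [Module.finrank_prod, TwelveDim.finrank_mLie hk, finrank_abelianLie]
      omega
    · obtain ⟨d, hd⟩ : ∃ d, n - 12 = d + 2 := ⟨n - 14, by omega⟩
      rw [hd]
      exact isAnosovLieAlgebra_mLie_prod hk d
  exact ⟨⟨_, _, _, main 2 two_pos Nat.prime_two.prime.not_isSquare⟩, main⟩
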